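/- For a subgroup $G$ of the symmetric group $S_n$, let $P(G)\subset\mathbb{R}^{n\times n}$ be the convex hull of the permutation matrices of the elements of $G$, and let $A_n\le S_n$ be the alternating group. A polytope $P$ is called $k$-level if for every facet-defining inequality $c\cdot x-\alpha\ge 0$ of $P$ all vertices of $P$ lie on at most $k$ hyperplanes parallel to $\{x: c\cdot x=\alpha\}$, this one included (two-level means $k=2$); $P$ is at least $m$-level if it is not $k$-level for any $k<m$. Let $I(G)\subset\mathbb{R}[x_{ij}:1\le i,j\le n]$ be the ideal of all polynomials vanishing on the vertices of $P(G)$, and let $TH_1(I(G))$ be its first theta body, that is, the set of all $x\in\mathbb{R}^{n\times n}$ such that $f(x)\ge 0$ for every polynomial $f$ of degree at most one that is congruent modulo $I(G)$ to a sum of squares of polynomials of degree at most one. The group $G$ is called $TH_1$-exact if $TH_1(I(G))=P(G)$. For every integer $n\ge 0$, the polytope $P(A_n)$ is two-level if and only if $n\le 4$, and $A_n$ is $TH_1$-exact if and only if $n\le 4$. Moreover, for $n\ge 8$, $P(A_n)$ is at least $(\lfloor n/4\rfloor+1)$-level. -/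

import Mathlib

/-- The permutation polytope `P(G)` of a permutation group `G ≤ Sₙ`: the convex hull, in the
space of real `n × n` matrices, of the permutation matrices of the elements of `G`. -/
def permPolytope {n : ℕ} (G : Subgroup (Equiv.Perm (Fin n))) :
    Set (Matrix (Fin n) (Fin n) ℝ) :=
  convexHull ℝ {M | ∃ g ∈ G, M = g.permMatrix ℝ}

/-- The inequality `c x - α ≥ 0` (with `c` a linear functional) is facet-defining for `P`: it is
valid on `P`, and the face `{x ∈ P | c x = α}` is nonempty of dimension `dim P - 1`. -/
def IsFacetInequality {E : Type*} [AddCommGroup E] [Module ℝ E]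
    (P : Set E) (c : E →ₗ[ℝ] ℝ) (α : ℝ) : Prop :=
  (∀ x ∈ P, 0 ≤ c x - α) ∧
  {x ∈ P | c x = α}.Nonempty ∧
  Module.finrank ℝ (vectorSpan ℝ {x ∈ P | c x = α}) + 1 = Module.finrank ℝ (vectorSpan ℝ P)

/-- `P` is two-level: for every facet-defining inequality `c x - α ≥ 0` of `P` there is a
hyperplane `c x - β = 0` parallel to `c x - α = 0` such that every vertex of `P` lies on one of
the two. -/
def IsTwoLevel {E : Type*} [AddCommGroup E] [Module ℝ E] (P : Set E) : Prop :=
  ∀ (c : E →ₗ[ℝ] ℝ) (α : ℝ), IsFacetInequality P c α →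
    ∃ β : ℝ, P.extremePoints ℝ ⊆ {x | c x - α = 0} ∪ {x | c x - β = 0}

/-- `P` is `k`-level: for every facet-defining inequality `c x - α ≥ 0` of `P`, the vertices of
`P` lie on at most `k` hyperplanes parallel to `c x - α = 0`, that one included. -/
def IsKLevel {E : Type*} [AddCommGroup E] [Module ℝ E] (k : ℕ) (P : Set E) : Prop :=
  ∀ (c : E →ₗ[ℝ] ℝ) (α : ℝ), IsFacetInequality P c α →
    ∃ B : Finset ℝ, α ∈ B ∧ B.card ≤ k ∧ ∀ v ∈ P.extremePoints ℝ, c v ∈ B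

/-- `P` is at least `m`-level: it is `k`-level for no `k < m`. -/
def IsAtLeastLevel {E : Type*} [AddCommGroup E] [Module ℝ E] (m : ℕ) (P : Set E) : Prop :=
  ∀ k : ℕ, IsKLevel k P → m ≤ k

/-- Being two-level is the case `k = 2` of being `k`-level. -/
theorem isTwoLevel_iff_isKLevel_two {E : Type*} [AddCommGroup E] [Module ℝ E] (P : Set E) :
    IsTwoLevel P ↔ IsKLevel 2 P := by
  refine forall_congr' fun c => forall_congr' fun α => imp_congr_right fun _ => ?_
  constructor
  · rintro ⟨β, h⟩
    refine ⟨{α, β}, by simp, Finset.card_le_two, fun v hv => ?_⟩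
    rcases h hv with h | h <;> simp only [Set.mem_ofPred_eq, sub_eq_zero] at h <;> simp [h]
  · rintro ⟨B, hα, hB, h⟩
    have h1 : (B.erase α).card ≤ 1 := by
      rw [Finset.card_erase_of_mem hα]; omega
    obtain ⟨β, hβ⟩ := Finset.card_le_one_iff_subset_singleton.1 h1
    refine ⟨β, fun v hv => ?_⟩
    by_cases hv' : c v = α
    · left; simp [hv']
    · right
      have := hβ (Finset.mem_erase.2 ⟨hv', h v hv⟩)
      simp only [Finset.mem_singleton] at this
      simp [this]

/-- A polynomial `f` is `k`-sos modulo the ideal `I`: it is congruent modulo `I` to a sum of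
squares of finitely many polynomials of degree at most `k`. -/
def IsSosMod {σ : Type*} (k : ℕ) (I : Ideal (MvPolynomial σ ℝ)) (f : MvPolynomial σ ℝ) : Prop :=
  ∃ (m : ℕ) (h : Fin m → MvPolynomial σ ℝ),
    (∀ j, (h j).totalDegree ≤ k) ∧ f - ∑ j, h j ^ 2 ∈ I

/-- The `k`-th theta body `TH_k(I)` of an ideal `I`: the set of points at which every polynomial
of degree at most one that is `k`-sos modulo `I` is nonnegative. -/
def thetaBody {σ : Type*} (k : ℕ) (I : Ideal (MvPolynomial σ ℝ)) : Set (σ → ℝ) :=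
  {x | ∀ f : MvPolynomial σ ℝ, f.totalDegree ≤ 1 → IsSosMod k I f → 0 ≤ MvPolynomial.eval x f}

/-- A matrix as the point with coordinates `x_{ij}`. -/
def matrixPoint {n : ℕ} (X : Matrix (Fin n) (Fin n) ℝ) : Fin n × Fin n → ℝ :=
  fun p => X p.1 p.2

/-- The vanishing ideal in `ℝ[x_{ij} : 1 ≤ i, j ≤ n]` of the vertex set of `P(G)`. -/
noncomputable def vertexIdeal {n : ℕ} (G : Subgroup (Equiv.Perm (Fin n))) :
    Ideal (MvPolynomial (Fin n × Fin n) ℝ) :=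
  MvPolynomial.vanishingIdeal ℝ (matrixPoint '' (permPolytope G).extremePoints ℝ)

/-- `G` is `TH₁`-exact: `TH₁(I) = P(G)` for the vanishing ideal `I` of the vertices of `P(G)`. -/
def IsTH1Exact {n : ℕ} (G : Subgroup (Equiv.Perm (Fin n))) : Prop :=
  thetaBody 1 (vertexIdeal G) = matrixPoint '' permPolytope G

/-!
Write `S` for the set of vertices of `P(G)`, which by Birkhoff's theorem consists of all permutation
matrices of elements of `G`.

*Exactness implies two-levelness*, for every `G` (`IsTH1Exact.isTwoLevel`). Let `c ≥ α` be a facet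
inequality with vertices `a`, `b` at heights `0 < c a - α < c b - α`. As the facet has codimension
one, evaluation of affine functions at `b` is `r` times evaluation at `a`, with
`r = (c b - α) / (c a - α) > 1`, plus a combination of evaluations at vertices of the facet. Hence
for `t` with `t * r < 1 < t * r ^ 2` and small `ε > 0` the signed measure
`∑ δ_w + ε (t δ_b - δ_a)`, the sum running over the vertices `w` of the facet, is nonnegative on
squares of affine functions but negative on `c - α`. Its normalized mean is a point of the theta
body that violates the facet inequality (`IsFacetInequality.exists_weights`).

*Exactness for `n ≤ 4`* (`isTH1Exact_of_transversal`). For `n = 4` the cosets of the Klein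
four-group split `S` into three classes of four matrices, each with sum the all-ones matrix, and the
indicator function of any choice of one vertex per class is affine on `S`, namely a normalized count
of agreements. An indicator function is its own square, so it is nonnegative on the theta body. A
point of the theta body is an affine combination of `S`; moving the minimal coefficient of each
class to one common class makes all coefficients nonnegative. For `n ≤ 3` a single class works.

*Levels for `n ≥ 6`* (`half_le_of_isKLevel`). Multiplication by a fixed odd permutation identifies
even with odd permutations. An odd permutation has at least one excedance, and this defines a facet:
a weight that is constant on the transpositions and on the four-cycles `a ↦ d ↦ c ↦ b ↦ a` with
`a < b < c < d`, all of which have one excedance, is up to potentials a multiple of the excedance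
count. The cycles `(0 1 … i)` with `i` odd then give `n / 2` distinct levels, which is at least
`n / 4 + 1` and more than two. For `n = 5` the same face has codimension two, and a tilted weight
(`parityWeight`) defines a facet with more than two levels.
-/

/-! ### Faces of codimension one -/

theorem finrank_inf_ker_add_one {E : Type*} [AddCommGroup E] [Module ℝ E] [FiniteDimensional ℝ E]
    (V : Submodule ℝ E) (c : E →ₗ[ℝ] ℝ) (h : ∃ y ∈ V, c y ≠ 0) :
    Module.finrank ℝ ↥(V ⊓ LinearMap.ker c) + 1 = Module.finrank ℝ V := by
  obtain ⟨y, hy, hcy⟩ := h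
  have h0 : c.domRestrict V ≠ 0 := fun h => hcy (by simpa using LinearMap.congr_fun h ⟨y, hy⟩)
  have h1 := Module.Dual.finrank_ker_add_one_of_ne_zero (f := c.domRestrict V) h0
  rw [← h1, ← Submodule.map_comap_subtype, Submodule.finrank_map_subtype_eq,
    LinearMap.ker_domRestrict]

theorem le_of_mem_convexHull {E : Type*} [AddCommGroup E] [Module ℝ E] {S : Set E}
    {c : E →ₗ[ℝ] ℝ} {α : ℝ} (hS : ∀ s ∈ S, α ≤ c s) {x : E} (hx : x ∈ convexHull ℝ S) :
    α ≤ c x :=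
  convexHull_min hS (convex_halfSpace_ge c.isLinear α) hx

/-- The face of a convex hull cut out by a valid inequality is the convex hull of the generators on
it. -/
theorem mem_convexHull_face {E : Type*} [AddCommGroup E] [Module ℝ E] {S : Set E}
    {c : E →ₗ[ℝ] ℝ} {α : ℝ} (hS : ∀ s ∈ S, α ≤ c s) {x : E} (hx : x ∈ convexHull ℝ S)
    (hcx : c x = α) : x ∈ convexHull ℝ {s ∈ S | c s = α} := by
  classical
  obtain ⟨ι, _, w, z, hw, hw1, hz, rfl⟩ := mem_convexHull_iff_exists_fintype.1 hx
  have hsum : ∑ i, w i * (c (z i) - α) = 0 := by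
    simp only [map_sum, map_smul, smul_eq_mul] at hcx
    simp only [mul_sub, Finset.sum_sub_distrib, ← Finset.sum_mul, hw1, hcx]; ring
  have hz0 : ∀ i, w i ≠ 0 → c (z i) = α := fun i hi => by
    have := (Finset.sum_eq_zero_iff_of_nonneg fun i _ =>
      mul_nonneg (hw i) (sub_nonneg.2 (hS _ (hz i)))).1 hsum i (Finset.mem_univ i)
    linarith [(mul_eq_zero.1 this).resolve_left hi]
  obtain ⟨i₀, hi₀⟩ : ∃ i, w i ≠ 0 := by
    by_contra! h
    simp [h] at hw1
  refine mem_convexHull_of_exists_fintype w (fun i => if w i = 0 then z i₀ else z i) hw hw1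
    (fun i => ?_) (Finset.sum_congr rfl fun i _ => ?_)
  · by_cases hi : w i = 0
    · simp [hi, hz, hz0 _ hi₀]
    · simp [hi, hz, hz0 _ hi]
  · by_cases hi : w i = 0 <;> simp [hi]

/-- The valid inequality `c ≥ α` defines a facet of `convexHull ℝ S` as soon as every functional
that is constant on the points of `S` where `c = α` is, on `S`, an affine function of `c`. -/
theorem isFacetInequality_of_rigid {E : Type*} [AddCommGroup E] [Module ℝ E]
    [FiniteDimensional ℝ E] {S : Set E} {c : E →ₗ[ℝ] ℝ} {α : ℝ} (hS : ∀ s ∈ S, α ≤ c s)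
    (hface : ∃ s ∈ S, c s = α) (hne : ∃ s ∈ S, c s ≠ α)
    (hrigid : ∀ (h : E →ₗ[ℝ] ℝ) (β : ℝ), (∀ s ∈ S, c s = α → h s = β) →
      ∃ k : ℝ, ∀ s ∈ S, h s - β = k * (c s - α)) :
    IsFacetInequality (convexHull ℝ S) c α := by
  obtain ⟨w, hw, hcw⟩ := hface
  obtain ⟨a, ha, hca⟩ := hne
  have hsub : S ⊆ convexHull ℝ S := subset_convexHull ℝ S
  refine ⟨fun x hx => sub_nonneg.2 (le_of_mem_convexHull hS hx), ⟨w, hsub hw, hcw⟩, ?_⟩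
  rw [← finrank_inf_ker_add_one (vectorSpan ℝ (convexHull ℝ S)) c
    ⟨a - w, vsub_mem_vectorSpan ℝ (hsub ha) (hsub hw), by simp [hcw, sub_eq_zero, hca]⟩]
  set F : Set E := {x ∈ convexHull ℝ S | c x = α} with hF
  suffices h : vectorSpan ℝ F = vectorSpan ℝ (convexHull ℝ S) ⊓ LinearMap.ker c by rw [h]
  refine le_antisymm (le_inf (vectorSpan_mono ℝ fun x hx => hx.1) ?_) fun y hy => ?_
  · refine Submodule.span_le.2 ?_
    rintro _ ⟨x, hx, y, hy, rfl⟩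
    simp [hx.2, hy.2]
  · by_contra hyF
    obtain ⟨h, hhy, hker⟩ := Submodule.exists_le_ker_of_notMem hyF
    obtain ⟨k, hk⟩ := hrigid h (h w) fun s hs hcs => by
      have : h (s - w) = 0 :=
        hker (vsub_mem_vectorSpan ℝ (s := F) ⟨hsub hs, hcs⟩ ⟨hsub hw, hcw⟩)
      rwa [map_sub, sub_eq_zero] at this
    have hV : vectorSpan ℝ (convexHull ℝ S) ≤ LinearMap.ker (h - k • c) := by
      rw [← direction_affineSpan, affineSpan_convexHull, direction_affineSpan]
      refine Submodule.span_le.2 ?_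
      rintro _ ⟨x, hx, y, hy, rfl⟩
      have h1 := hk x hx
      have h2 := hk y hy
      simp only [vsub_eq_sub, SetLike.mem_coe, LinearMap.mem_ker, LinearMap.sub_apply, map_sub,
        LinearMap.smul_apply, smul_eq_mul]
      linarith
    have h1 := hV hy.1
    have h2 : c y = 0 := hy.2
    simp only [LinearMap.mem_ker, LinearMap.sub_apply, LinearMap.smul_apply, h2] at h1
    exact hhy (by simpa using h1)

/-- If `c ≥ α` defines a facet of the hull of the points `v i`, then these points are determined
affinely by those on the facet and one further point `v a`: the coefficient of `v a` in `v b` is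
the quotient of their heights above the facet. -/
theorem IsFacetInequality.exists_eq_add_sum {E ι : Type*} [AddCommGroup E] [Module ℝ E]
    [FiniteDimensional ℝ E] [Fintype ι] {v : ι → E} {c : E →ₗ[ℝ] ℝ} {α : ℝ}
    (hF : IsFacetInequality (convexHull ℝ (Set.range v)) c α) {a : ι} (ha : c (v a) ≠ α) (b : ι) :
    ∃ μ : ι → ℝ, (∀ i, c (v i) ≠ α → μ i = 0) ∧
      (c (v b) - α) / (c (v a) - α) + ∑ i, μ i = 1 ∧
      v b = ((c (v b) - α) / (c (v a) - α)) • v a + ∑ i, μ i • v i := by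
  classical
  obtain ⟨hvalid, ⟨w₀, hw₀, hcw₀⟩, hdim⟩ := hF
  have hsub : Set.range v ⊆ convexHull ℝ (Set.range v) := subset_convexHull ℝ _
  have hS : ∀ s ∈ Set.range v, α ≤ c s := fun s hs => sub_nonneg.1 (hvalid s (hsub hs))
  set F : Set E := {x ∈ convexHull ℝ (Set.range v) | c x = α} with hFdef
  have hFsub : F ⊆ convexHull ℝ {s ∈ Set.range v | c s = α} :=
    fun x hx => mem_convexHull_face hS hx.1 hx.2
  obtain ⟨w, hcw⟩ : ∃ i, c (v i) = α := by
    obtain ⟨_, ⟨i, rfl⟩, hi⟩ := convexHull_nonempty_iff.1 ⟨w₀, hFsub ⟨hw₀, hcw₀⟩⟩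
    exact ⟨i, hi⟩
  have hle : vectorSpan ℝ F ≤
      vectorSpan ℝ (convexHull ℝ (Set.range v)) ⊓ LinearMap.ker c := by
    refine le_inf (vectorSpan_mono ℝ fun x hx => hx.1) (Submodule.span_le.2 ?_)
    rintro _ ⟨x, hx, y, hy, rfl⟩
    simp [hx.2, hy.2]
  have hva : v a - v w ∈ vectorSpan ℝ (convexHull ℝ (Set.range v)) :=
    vsub_mem_vectorSpan ℝ (hsub ⟨a, rfl⟩) (hsub ⟨w, rfl⟩)
  have hvb : v b - v w ∈ vectorSpan ℝ (convexHull ℝ (Set.range v)) :=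
    vsub_mem_vectorSpan ℝ (hsub ⟨b, rfl⟩) (hsub ⟨w, rfl⟩)
  have heq := Submodule.eq_of_le_of_finrank_eq hle (by
    have := finrank_inf_ker_add_one (vectorSpan ℝ (convexHull ℝ (Set.range v))) c
      ⟨v a - v w, hva, by simp [hcw, sub_eq_zero, ha]⟩
    omega)
  set r := (c (v b) - α) / (c (v a) - α) with hr
  have hmem : v b - v w - r • (v a - v w) ∈ vectorSpan ℝ F := by
    rw [heq]
    refine ⟨sub_mem hvb (Submodule.smul_mem _ _ hva), ?_⟩
    have : c (v a) - α ≠ 0 := sub_ne_zero.2 ha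
    simp only [SetLike.mem_coe, LinearMap.mem_ker, map_sub, map_smul, hcw, smul_eq_mul, hr]
    field_simp
    ring
  let I : Finset ι := {i | c (v i) = α}
  have hI : {s ∈ Set.range v | c s = α} = v '' I := by
    ext s
    constructor
    · rintro ⟨⟨i, rfl⟩, hi⟩
      exact ⟨i, by simpa [I] using hi, rfl⟩
    · rintro ⟨i, hi, rfl⟩
      exact ⟨⟨i, rfl⟩, by simpa [I] using hi⟩
  have hmem2 : v b - v w - r • (v a - v w) ∈ Submodule.span ℝ ((fun i => v i - v w) '' I) := by
    have h1 : vectorSpan ℝ F ≤ vectorSpan ℝ (v '' I) := by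
      rw [← hI]
      refine (vectorSpan_mono ℝ hFsub).trans ?_
      rw [← direction_affineSpan, affineSpan_convexHull, direction_affineSpan]
    have h2 := h1 hmem
    rw [vectorSpan_eq_span_vsub_set_right ℝ (p := v w)
      (Set.mem_image_of_mem v (by simpa [I] using hcw)),
      Set.image_image] at h2
    exact h2
  rw [Submodule.mem_span_image_finset_iff_exists_fun] at hmem2
  obtain ⟨l, hl⟩ := hmem2
  let l' : ι → ℝ := fun i => if h : i ∈ I then l ⟨i, h⟩ else 0
  have hl' : ∑ i, l' i • (v i - v w) = v b - v w - r • (v a - v w) := by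
    rw [← hl, ← Finset.sum_subset (Finset.subset_univ I) (fun i _ hi => by simp [l', hi]),
      ← Finset.sum_coe_sort I]
    simp [l']
  refine ⟨fun i => l' i + if i = w then 1 - r - ∑ j, l' j else 0, fun i hi => ?_, ?_, ?_⟩
  · have h1 : i ∉ I := by simpa [I] using hi
    have h2 : i ≠ w := fun h => hi (h ▸ hcw)
    simp [l', h1, h2]
  · simp [Finset.sum_add_distrib]
  · simp only [add_smul, Finset.sum_add_distrib, ite_smul, zero_smul, Finset.sum_ite_eq',
      Finset.mem_univ, if_true]
    simp only [smul_sub, Finset.sum_sub_distrib, ← Finset.sum_smul] at hl'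
    rw [sub_eq_iff_eq_add] at hl'
    rw [hl']
    module

/-- A facet on which the points `v i` have two distinct positive heights gives a signed measure on
the points that is nonnegative on squares of affine functions but has its mean strictly on the
wrong side of the facet. -/
theorem IsFacetInequality.exists_weights {E ι : Type*} [AddCommGroup E] [Module ℝ E]
    [FiniteDimensional ℝ E] [Fintype ι] {v : ι → E} {c : E →ₗ[ℝ] ℝ} {α : ℝ}
    (hF : IsFacetInequality (convexHull ℝ (Set.range v)) c α) {a b : ι} (ha : α < c (v a))
    (hab : c (v a) < c (v b)) :
    ∃ y : ι → ℝ, ∑ i, y i = 1 ∧ (∀ (h : E →ₗ[ℝ] ℝ) (e : ℝ), 0 ≤ ∑ i, y i * (h (v i) + e) ^ 2) ∧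
      ∑ i, y i * c (v i) < α := by
  classical
  obtain ⟨μ, hμ0, hμ1, hμ⟩ := hF.exists_eq_add_sum ha.ne' b
  set r := (c (v b) - α) / (c (v a) - α) with hr
  have hr1 : 1 < r := by rw [hr, one_lt_div] <;> linarith
  have hrc : c (v b) - α = r * (c (v a) - α) := by
    rw [hr, div_mul_cancel₀]; linarith
  -- `t` is chosen with `t * r < 1 < t * r ^ 2`
  set t := (1 + r) / (2 * r ^ 2) with ht
  have ht2 : t * r ^ 2 = (1 + r) / 2 := by rw [ht]; field_simp
  have ht1 : t * r < 1 := by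
    rw [ht, div_mul_eq_mul_div, div_lt_one (by positivity)]; nlinarith
  have ht0 : 0 < t := by positivity
  set K := (∑ i, μ i ^ 2) * (t * 2 / (r - 1)) with hK
  have hK0 : 0 ≤ K := mul_nonneg (Finset.sum_nonneg fun i _ => sq_nonneg _)
    (div_nonneg (by positivity) (by linarith))
  set ε := 1 / (K + 1) with hε
  have hε0 : 0 < ε := by positivity
  have hεK : ε * K ≤ 1 := by
    rw [hε, div_mul_eq_mul_div, one_mul, div_le_one (by positivity)]; linarith
  have hε1 : ε ≤ 1 := by
    rw [hε, div_le_one (by positivity)]; linarith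
  let y : ι → ℝ := fun i => (if c (v i) = α then 1 else 0) +
    ε * (t * (if i = b then 1 else 0) - (if i = a then 1 else 0))
  have hy : ∀ g : ι → ℝ, ∑ i, y i * g i =
      (∑ i, if c (v i) = α then g i else 0) + ε * (t * g b - g a) := fun g => by
    simp only [y, add_mul, mul_assoc, sub_mul, Finset.sum_add_distrib, ← Finset.mul_sum,
      Finset.sum_sub_distrib, ite_mul, one_mul, zero_mul, Finset.sum_ite_eq', Finset.mem_univ,
      if_true]
  obtain ⟨w, hw⟩ : ∃ w, c (v w) = α := by
    by_contra! h
    simp only [fun i => hμ0 i (h i), Finset.sum_const_zero] at hμ1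
    linarith
  have hZ : 0 < ∑ i, y i := by
    have h1 := hy fun _ => 1
    simp only [mul_one] at h1
    have h2 : (1 : ℝ) ≤ ∑ i, if c (v i) = α then (1 : ℝ) else 0 := by
      have := Finset.single_le_sum (f := fun i => if c (v i) = α then (1 : ℝ) else 0)
        (fun i _ => by positivity) (Finset.mem_univ w)
      simpa [hw] using this
    rw [h1]
    nlinarith [mul_pos hε0 ht0]
  have hsq : ∀ (h : E →ₗ[ℝ] ℝ) (e : ℝ), 0 ≤ ∑ i, y i * (h (v i) + e) ^ 2 := fun h e => by
    rw [hy]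
    set l := ∑ i, μ i * (h (v i) + e) with hl
    set N := ∑ i, if c (v i) = α then (h (v i) + e) ^ 2 else 0 with hN
    have hN0 : 0 ≤ N := Finset.sum_nonneg fun i _ => by positivity
    have hB : h (v b) + e = r * (h (v a) + e) + l := by
      have h1 : l = ∑ i, μ i * h (v i) + (∑ i, μ i) * e := by
        simp only [hl, mul_add, Finset.sum_add_distrib, Finset.sum_mul]
      have h2 := congrArg h hμ
      simp only [map_add, map_sum, map_smul, smul_eq_mul] at h2
      rw [h1, h2]
      linear_combination (-e) * hμ1
    have hlN : l ^ 2 ≤ (∑ i, μ i ^ 2) * N := by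
      have h1 : l = ∑ i, μ i * (if c (v i) = α then h (v i) + e else 0) :=
        Finset.sum_congr rfl fun i _ => by
          by_cases hi : c (v i) = α
          · simp [hi]
          · simp [hμ0 i hi]
      have h2 : N = ∑ i, (if c (v i) = α then h (v i) + e else 0) ^ 2 :=
        Finset.sum_congr rfl fun i _ => by split_ifs <;> simp
      rw [h1, h2]
      exact Finset.sum_mul_sq_le_sq_mul_sq _ _ _
    -- completing the square in the value at `v a`
    have hlow : -(t * 2 / (r - 1)) * l ^ 2 ≤ t * (h (v b) + e) ^ 2 - (h (v a) + e) ^ 2 := by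
      have hr0 : r - 1 ≠ 0 := by linarith
      have h1 : t * (h (v b) + e) ^ 2 - (h (v a) + e) ^ 2 + t * 2 / (r - 1) * l ^ 2 =
          (r - 1) / 2 * (h (v a) + e + 2 * (t * r) / (r - 1) * l) ^ 2 := by
        rw [hB]
        field_simp
        linear_combination (2 * (r - 1) * (h (v a) + e) ^ 2 - 4 * t * l ^ 2) * ht2
      have h2 : 0 ≤ (r - 1) / 2 * (h (v a) + e + 2 * (t * r) / (r - 1) * l) ^ 2 :=
        mul_nonneg (by linarith) (sq_nonneg _)
      linarith
    have hKN : t * 2 / (r - 1) * l ^ 2 ≤ K * N := by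
      rw [hK, mul_comm (∑ i, μ i ^ 2), mul_assoc]
      exact mul_le_mul_of_nonneg_left hlN (div_nonneg (by positivity) (by linarith))
    nlinarith [mul_le_mul_of_nonneg_left (show -(K * N) ≤
      t * (h (v b) + e) ^ 2 - (h (v a) + e) ^ 2 by linarith) hε0.le,
      mul_le_mul_of_nonneg_right hεK hN0]
  refine ⟨fun i => y i / ∑ j, y j, ?_, fun h e => ?_, ?_⟩
  · rw [← Finset.sum_div, div_self hZ.ne']
  · simp only [div_mul_eq_mul_div, ← Finset.sum_div]
    exact div_nonneg (hsq h e) hZ.le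
  · simp only [div_mul_eq_mul_div, ← Finset.sum_div]
    rw [div_lt_iff₀ hZ, ← sub_neg]
    have h1 := hy fun i => c (v i) - α
    have h2 : (∑ i, if c (v i) = α then c (v i) - α else 0) = 0 :=
      Finset.sum_eq_zero fun i _ => by split_ifs with h <;> simp [h]
    simp only [h2, mul_sub, Finset.sum_sub_distrib, ← Finset.sum_mul, zero_add] at h1
    have h3 : ε * ((t * r - 1) * (c (v a) - α)) < 0 :=
      mul_neg_of_pos_of_neg hε0 (mul_neg_of_neg_of_pos (by linarith) (by linarith))
    have h4 : t * (c (v b) - α) = t * r * (c (v a) - α) := by rw [hrc]; ring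
    nlinarith

/-! ### Polynomials of degree at most one and the first theta body -/

theorem MvPolynomial.exists_eval_eq_of_totalDegree_le_one {σ : Type*} [Fintype σ]
    {p : MvPolynomial σ ℝ} (hp : p.totalDegree ≤ 1) :
    ∃ (a : σ → ℝ) (b : ℝ), ∀ x, MvPolynomial.eval x p = ∑ i, a i * x i + b := by
  classical
  suffices h : ∃ (a : σ → ℝ) (b : ℝ),
      (∑ d ∈ p.support, fun x : σ → ℝ => p.coeff d * ∏ i, x i ^ d i) =
        fun x => ∑ i, a i * x i + b by
    obtain ⟨a, b, h⟩ := h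
    refine ⟨a, b, fun x => ?_⟩
    rw [MvPolynomial.eval_eq', ← congrFun h x, Finset.sum_apply]
  refine Finset.sum_induction _ (fun f : (σ → ℝ) → ℝ => ∃ (a : σ → ℝ) (b : ℝ),
    f = fun x => ∑ i, a i * x i + b) ?_ ⟨0, 0, by ext; simp⟩ fun d hd => ?_
  · rintro _ _ ⟨a, b, rfl⟩ ⟨a', b', rfl⟩
    refine ⟨a + a', b + b', ?_⟩
    ext x
    simp only [Pi.add_apply, add_mul, Finset.sum_add_distrib]
    ring
  · rcases Nat.le_one_iff_eq_zero_or_eq_one.1 ((MvPolynomial.le_totalDegree hd).trans hp) with h | h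
    · obtain rfl : d = 0 := by
        ext i
        by_contra hi
        have := (Finset.sum_eq_zero_iff.1 h) i (Finsupp.mem_support_iff.2 hi)
        exact hi this
      exact ⟨0, p.coeff 0, by ext; simp⟩
    · obtain ⟨i, rfl⟩ := (Finsupp.sum_eq_one_iff d).1 h
      refine ⟨Pi.single i (p.coeff (Finsupp.single i 1)), 0, ?_⟩
      ext x
      rw [Finset.prod_eq_single i (fun j _ hj => by simp [hj.symm]) (by simp),
        Finset.sum_eq_single i (fun j _ hj => by simp [hj]) (by simp)]
      simp

theorem exists_linearMap_of_totalDegree_le_one {n : ℕ} {p : MvPolynomial (Fin n × Fin n) ℝ}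
    (hp : p.totalDegree ≤ 1) : ∃ (h : Matrix (Fin n) (Fin n) ℝ →ₗ[ℝ] ℝ) (e : ℝ),
      ∀ X, MvPolynomial.eval (matrixPoint X) p = h X + e := by
  obtain ⟨a, b, hab⟩ := MvPolynomial.exists_eval_eq_of_totalDegree_le_one hp
  refine ⟨∑ q, a q • Matrix.entryLinearMap ℝ ℝ q.1 q.2, b, fun X => ?_⟩
  simp [hab, matrixPoint]

theorem exists_polynomial_of_linearMap {n : ℕ} (h : Matrix (Fin n) (Fin n) ℝ →ₗ[ℝ] ℝ) (e : ℝ) :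
    ∃ p : MvPolynomial (Fin n × Fin n) ℝ, p.totalDegree ≤ 1 ∧
      ∀ X, MvPolynomial.eval (matrixPoint X) p = h X + e := by
  refine ⟨∑ q, MvPolynomial.C (h (Matrix.single q.1 q.2 1)) * MvPolynomial.X q +
    MvPolynomial.C e, ?_, fun X => ?_⟩
  · refine (MvPolynomial.totalDegree_add _ _).trans (max_le ?_ (by simp))
    refine MvPolynomial.totalDegree_finsetSum_le fun q _ => ?_
    refine (MvPolynomial.totalDegree_mul _ _).trans ?_
    simp
  · have h1 : h X = ∑ q : Fin n × Fin n, h (Matrix.single q.1 q.2 1) * X q.1 q.2 := by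
      conv_lhs => rw [Matrix.matrix_eq_sum_single X]
      simp only [map_sum, Fintype.sum_prod_type]
      refine Finset.sum_congr rfl fun i _ => Finset.sum_congr rfl fun j _ => ?_
      rw [mul_comm, ← smul_eq_mul, ← map_smul, Matrix.smul_single, smul_eq_mul, mul_one]
    simp [h1, matrixPoint]

theorem matrixPoint_injective {n : ℕ} : Function.Injective (matrixPoint (n := n)) :=
  fun X Y h => by
    ext i j
    exact congrFun h (i, j)

/-! ### Permutation polytopes -/

theorem permMatrix_apply' {n : ℕ} (g : Equiv.Perm (Fin n)) (i j : Fin n) :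
    g.permMatrix ℝ i j = if g i = j then 1 else 0 := by
  simp [PEquiv.toMatrix_apply, eq_comm]

/-- The vertices of `permPolytope G`, indexed by the elements of `G`. -/
def vertex {n : ℕ} (G : Subgroup (Equiv.Perm (Fin n))) (g : G) : Matrix (Fin n) (Fin n) ℝ :=
  (g : Equiv.Perm (Fin n)).permMatrix ℝ

theorem range_vertex {n : ℕ} (G : Subgroup (Equiv.Perm (Fin n))) :
    Set.range (vertex G) = {M | ∃ g ∈ G, M = g.permMatrix ℝ} := by
  ext M
  simp [vertex, eq_comm]

theorem permPolytope_eq {n : ℕ} (G : Subgroup (Equiv.Perm (Fin n))) :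
    permPolytope G = convexHull ℝ (Set.range (vertex G)) := by
  rw [range_vertex, permPolytope]

theorem extremePoints_permPolytope {n : ℕ} (G : Subgroup (Equiv.Perm (Fin n))) :
    (permPolytope G).extremePoints ℝ = Set.range (vertex G) := by
  rw [permPolytope_eq]
  refine (extremePoints_convexHull_subset).antisymm ?_
  rintro _ ⟨g, rfl⟩
  have hsub : convexHull ℝ (Set.range (vertex G)) ⊆ (doublyStochastic ℝ (Fin n) : Set _) := by
    rw [doublyStochastic_eq_convexHull_permMatrix]
    refine convexHull_mono ?_
    rintro _ ⟨g, rfl⟩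
    exact ⟨g, rfl⟩
  refine inter_extremePoints_subset_extremePoints_of_subset hsub
    ⟨subset_convexHull ℝ _ ⟨g, rfl⟩, ?_⟩
  rw [extremePoints_doublyStochastic]
  exact ⟨g, rfl⟩

theorem mem_vertexIdeal {n : ℕ} {G : Subgroup (Equiv.Perm (Fin n))}
    {p : MvPolynomial (Fin n × Fin n) ℝ} :
    p ∈ vertexIdeal G ↔ ∀ g, MvPolynomial.eval (matrixPoint (vertex G g)) p = 0 := by
  rw [vertexIdeal, extremePoints_permPolytope, MvPolynomial.mem_vanishingIdeal_iff, ← Set.range_comp,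
    Set.forall_mem_range]
  rfl

theorem isSosMod_vertexIdeal {n k : ℕ} {G : Subgroup (Equiv.Perm (Fin n))}
    {p : MvPolynomial (Fin n × Fin n) ℝ} :
    IsSosMod k (vertexIdeal G) p ↔ ∃ (m : ℕ) (h : Fin m → MvPolynomial (Fin n × Fin n) ℝ),
      (∀ j, (h j).totalDegree ≤ k) ∧ ∀ g, MvPolynomial.eval (matrixPoint (vertex G g)) p =
        ∑ j, MvPolynomial.eval (matrixPoint (vertex G g)) (h j) ^ 2 := by
  simp [IsSosMod, mem_vertexIdeal, sub_eq_zero]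

/-- A point of the first theta body satisfies every affine inequality whose slack takes only the
values `0` and `1` at the vertices: such a slack agrees there with its own square. -/
theorem nonneg_of_mem_thetaBody {n : ℕ} {G : Subgroup (Equiv.Perm (Fin n))}
    {X : Matrix (Fin n) (Fin n) ℝ} (hX : matrixPoint X ∈ thetaBody 1 (vertexIdeal G))
    (h : Matrix (Fin n) (Fin n) ℝ →ₗ[ℝ] ℝ) (e : ℝ)
    (hv : ∀ g, h (vertex G g) + e = 0 ∨ h (vertex G g) + e = 1) : 0 ≤ h X + e := by
  obtain ⟨p, hp, hpe⟩ := exists_polynomial_of_linearMap h e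
  rw [← hpe]
  refine hX p hp (isSosMod_vertexIdeal.2 ⟨1, fun _ => p, fun _ => hp, fun g => ?_⟩)
  rcases hv g with h | h <;> simp [hpe, h]

theorem image_permPolytope_subset_thetaBody {n k : ℕ} (G : Subgroup (Equiv.Perm (Fin n))) :
    matrixPoint '' permPolytope G ⊆ thetaBody k (vertexIdeal G) := by
  rintro _ ⟨X, hX, rfl⟩ p hp hsos
  obtain ⟨h, e, hpe⟩ := exists_linearMap_of_totalDegree_le_one hp
  obtain ⟨m, q, -, hq⟩ := isSosMod_vertexIdeal.1 hsos
  rw [permPolytope_eq] at hX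
  have := le_of_mem_convexHull (c := h) (α := -e) (by
    rintro _ ⟨g, rfl⟩
    have h1 := hq g
    rw [hpe] at h1
    have h2 : 0 ≤ ∑ j, MvPolynomial.eval (matrixPoint (vertex G g)) (q j) ^ 2 :=
      Finset.sum_nonneg fun j _ => sq_nonneg _
    linarith) hX
  rw [hpe]
  linarith

/-- If some facet had vertices at two distinct positive heights, then the weights of
`IsFacetInequality.exists_weights` would give a point of the theta body outside the polytope. -/
theorem IsTH1Exact.isTwoLevel {n : ℕ} {G : Subgroup (Equiv.Perm (Fin n))} (hG : IsTH1Exact G) :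
    IsTwoLevel (permPolytope G) := by
  classical
  intro c α hF
  rw [extremePoints_permPolytope]
  by_contra! hcon
  have hval : ∀ g, α ≤ c (vertex G g) := fun g => sub_nonneg.1 <| hF.1 _ <| by
    rw [permPolytope_eq]
    exact subset_convexHull ℝ _ ⟨g, rfl⟩
  obtain ⟨a, b, ha, hab⟩ : ∃ a b, α < c (vertex G a) ∧ c (vertex G a) < c (vertex G b) := by
    have h1 : ∀ β, ∃ g, c (vertex G g) ≠ α ∧ c (vertex G g) ≠ β := fun β => by
      obtain ⟨_, ⟨g, rfl⟩, hg⟩ := Set.not_subset.1 (hcon β)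
      simp only [Set.mem_union, Set.mem_ofPred_eq, sub_eq_zero, not_or] at hg
      exact ⟨g, hg⟩
    obtain ⟨a, ha, -⟩ := h1 α
    obtain ⟨b, hb, hab⟩ := h1 (c (vertex G a))
    rcases hab.lt_or_gt with h | h
    · exact ⟨b, a, (hval b).lt_of_ne hb.symm, h⟩
    · exact ⟨a, b, (hval a).lt_of_ne ha.symm, h⟩
  rw [permPolytope_eq] at hF
  obtain ⟨y, hy1, hysq, hyc⟩ := hF.exists_weights ha hab
  have hmean : ∀ (h : Matrix (Fin n) (Fin n) ℝ →ₗ[ℝ] ℝ) (e : ℝ),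
      h (∑ g, y g • vertex G g) + e = ∑ g, y g * (h (vertex G g) + e) := fun h e => by
    simp only [map_sum, map_smul, smul_eq_mul, mul_add, Finset.sum_add_distrib, ← Finset.sum_mul,
      hy1, one_mul]
  have hmem : matrixPoint (∑ g, y g • vertex G g) ∈ thetaBody 1 (vertexIdeal G) := by
    intro p hp hsos
    obtain ⟨h, e, hpe⟩ := exists_linearMap_of_totalDegree_le_one hp
    obtain ⟨m, q, hq1, hq⟩ := isSosMod_vertexIdeal.1 hsos
    simp only [hpe] at hq
    rw [hpe, hmean]
    simp only [hq, Finset.mul_sum]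
    rw [Finset.sum_comm]
    refine Finset.sum_nonneg fun j _ => ?_
    obtain ⟨h', e', hqe⟩ := exists_linearMap_of_totalDegree_le_one (hq1 j)
    simpa only [hqe] using hysq h' e'
  rw [hG] at hmem
  obtain ⟨X, hX, hXe⟩ := hmem
  rw [matrixPoint_injective hXe, permPolytope_eq] at hX
  have h1 := hF.1 _ hX
  have h2 := hmean c 0
  simp only [add_zero] at h2
  linarith

/-! ### Degree at most four -/

/-- Suppose the points `v i` fall into classes of equal size and equal sum. An affine combination
of them lies in their convex hull as soon as, for every choice of one point from each class, the
coefficients of the chosen points have nonnegative sum. -/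
theorem mem_convexHull_of_transversal {E ι κ : Type*} [AddCommGroup E] [Module ℝ E] [Fintype ι]
    [Fintype κ] [DecidableEq κ] (v : ι → E) (cls : ι → κ) (J : E) (N : ℕ)
    (hcls : Function.Surjective cls) (hJ : ∀ k, ∑ i with cls i = k, v i = J)
    (hN : ∀ k, Finset.card {i | cls i = k} = N) (l : ι → ℝ) (hl : ∑ i, l i = 1)
    (ht : ∀ t : κ → ι, (∀ k, cls (t k) = k) → 0 ≤ ∑ k, l (t k)) :
    ∑ i, l i • v i ∈ convexHull ℝ (Set.range v) := by
  have hmin : ∀ k, ∃ i, cls i = k ∧ ∀ j, cls j = k → l i ≤ l j := fun k => by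
    obtain ⟨i, hi⟩ := hcls k
    obtain ⟨j, hj, hmin⟩ := Finset.exists_min_image {i | cls i = k} l ⟨i, by simpa using hi⟩
    exact ⟨j, by simpa using hj, fun j' hj' => hmin j' (by simpa using hj')⟩
  choose t htc htmin using hmin
  obtain ⟨i₀⟩ : Nonempty ι := by
    by_contra h
    rw [not_nonempty_iff] at h
    simp at hl
  set s := ∑ k, l (t k) with hs
  have hs0 : 0 ≤ s := ht t htc
  -- Lower all coefficients by their class minimum, and give the total back to a single class.
  refine mem_convexHull_of_exists_fintype
    (fun i => l i - l (t (cls i)) + if cls i = cls i₀ then s else 0) v (fun i => ?_) ?_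
    (fun i => ⟨i, rfl⟩) ?_
  · have := htmin (cls i) i rfl
    split_ifs <;> linarith
  · have h1 : ∑ i, l (t (cls i)) = s * N := by
      rw [← Finset.sum_fiberwise_of_maps_to (g := cls) (t := Finset.univ) (by simp), hs,
        Finset.sum_mul]
      refine Finset.sum_congr rfl fun k _ => ?_
      rw [Finset.sum_congr rfl (g := fun _ => l (t k)) fun i hi => by
        rw [(Finset.mem_filter.1 hi).2], Finset.sum_const, hN, nsmul_eq_mul, mul_comm]
    rw [Finset.sum_add_distrib, Finset.sum_sub_distrib, hl, h1, ← Finset.sum_filter,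
      Finset.sum_const, hN, nsmul_eq_mul]
    ring
  · have h1 : ∑ i, l (t (cls i)) • v i = s • J := by
      rw [← Finset.sum_fiberwise_of_maps_to (g := cls) (t := Finset.univ) (by simp), hs,
        Finset.sum_smul]
      refine Finset.sum_congr rfl fun k _ => ?_
      rw [Finset.sum_congr rfl (g := fun i => l (t k) • v i) fun i hi => by
        rw [(Finset.mem_filter.1 hi).2], ← Finset.smul_sum, hJ]
    simp only [add_smul, sub_smul, Finset.sum_add_distrib, Finset.sum_sub_distrib, h1, ite_smul,
      zero_smul]
    rw [← Finset.sum_filter, ← Finset.smul_sum, hJ]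
    abel

/-- If the vertices fall into classes of equal size and equal sum, and the indicator function of every
choice of one vertex from each class is the restriction of an affine function, then `G` is
`TH₁`-exact: these indicators are squares on the vertices, hence nonnegative on the theta body. -/
theorem isTH1Exact_of_transversal {n : ℕ} {G : Subgroup (Equiv.Perm (Fin n))} [Fintype G]
    {κ : Type*} [Fintype κ] [DecidableEq κ] (cls : G → κ) (J : Matrix (Fin n) (Fin n) ℝ) (N : ℕ)
    (hcls : Function.Surjective cls) (hJ : ∀ k, ∑ g with cls g = k, vertex G g = J)
    (hN : ∀ k, Finset.card {g | cls g = k} = N)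
    (hind : ∀ t : κ → G, (∀ k, cls (t k) = k) → ∃ (h : Matrix (Fin n) (Fin n) ℝ →ₗ[ℝ] ℝ) (e : ℝ),
      ∀ g, h (vertex G g) + e = if t (cls g) = g then 1 else 0) :
    IsTH1Exact G := by
  refine (image_permPolytope_subset_thetaBody G).antisymm' fun x hx => ?_
  obtain ⟨X, rfl⟩ : ∃ X : Matrix (Fin n) (Fin n) ℝ, matrixPoint X = x :=
    ⟨fun i j => x (i, j), rfl⟩
  refine ⟨X, ?_, rfl⟩
  have hspan : X - vertex G 1 ∈ Submodule.span ℝ (Set.range fun g => vertex G g - vertex G 1) := by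
    by_contra hX
    obtain ⟨h, hne, hker⟩ := Submodule.exists_le_ker_of_notMem hX
    have h0 : ∀ g, h (vertex G g) = h (vertex G 1) := fun g => by
      have : h (vertex G g - vertex G 1) = 0 := hker (Submodule.subset_span ⟨g, rfl⟩)
      rwa [map_sub, sub_eq_zero] at this
    have h1 := nonneg_of_mem_thetaBody hx h (-h (vertex G 1)) fun g => by simp [h0 g]
    have h2 := nonneg_of_mem_thetaBody hx (-h) (h (vertex G 1)) fun g => by simp [h0 g]
    rw [LinearMap.neg_apply] at h2
    rw [map_sub] at hne
    exact hne (by linarith)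
  obtain ⟨l₀, hl₀⟩ := (Submodule.mem_span_range_iff_exists_fun ℝ).1 hspan
  obtain ⟨l, hl, rfl⟩ : ∃ l : G → ℝ, ∑ g, l g = 1 ∧ ∑ g, l g • vertex G g = X := by
    classical
    refine ⟨fun g => l₀ g + if g = 1 then 1 - ∑ g, l₀ g else 0, ?_, ?_⟩
    · simp [Finset.sum_add_distrib]
    · simp only [smul_sub, Finset.sum_sub_distrib, ← Finset.sum_smul] at hl₀
      rw [sub_eq_iff_eq_add] at hl₀
      simp only [add_smul, Finset.sum_add_distrib, ite_smul, zero_smul, Finset.sum_ite_eq',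
        Finset.mem_univ, if_true, hl₀]
      module
  rw [permPolytope_eq]
  refine mem_convexHull_of_transversal (vertex G) cls J N hcls hJ hN l hl fun t ht => ?_
  classical
  obtain ⟨h, e, hh⟩ := hind t ht
  have h1 := nonneg_of_mem_thetaBody hx h e fun g => by rw [hh]; split_ifs <;> simp
  have h2 : h (∑ g, l g • vertex G g) + e = ∑ g, l g * (h (vertex G g) + e) := by
    simp only [map_sum, map_smul, smul_eq_mul, mul_add, Finset.sum_add_distrib, ← Finset.sum_mul,
      hl, one_mul]
  rw [h2] at h1
  convert h1 using 1
  simp only [hh, mul_ite, mul_one, mul_zero]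
  rw [← Finset.sum_filter]
  refine Finset.sum_nbij t (fun k _ => by simp [ht]) (fun k _ k' _ hk => ?_) (fun g hg => ?_)
    fun _ _ => rfl
  · rw [← ht k, ← ht k', hk]
  · exact ⟨cls g, by simp, by simpa using hg⟩

/-- The functional `∑ k, ⟨M_{t k}, ·⟩`, whose value at the permutation matrix of `g` counts the
agreements of `g` with the permutations `t k`. -/
noncomputable def agreement {n : ℕ} {κ : Type*} [Fintype κ] (t : κ → Equiv.Perm (Fin n)) :
    Matrix (Fin n) (Fin n) ℝ →ₗ[ℝ] ℝ :=
  ∑ k, ∑ i, Matrix.entryLinearMap ℝ ℝ i (t k i)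

theorem agreement_vertex {n : ℕ} {G : Subgroup (Equiv.Perm (Fin n))} {κ : Type*} [Fintype κ]
    (t : κ → Equiv.Perm (Fin n)) (g : G) :
    agreement t (vertex G g) =
      ∑ k, (Finset.card {i | (g : Equiv.Perm (Fin n)) i = t k i} : ℝ) := by
  simp only [agreement, LinearMap.sum_apply, Matrix.entryLinearMap_apply, vertex, permMatrix_apply']
  simp

theorem isTH1Exact_alternatingGroup_of_le_two {n : ℕ} (hn : n ≤ 2) :
    IsTH1Exact (alternatingGroup (Fin n)) := by
  have h1 : ∀ g : alternatingGroup (Fin n), g = 1 := by interval_cases n <;> decide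
  refine isTH1Exact_of_transversal (κ := Unit) (fun _ => ()) 1 1 (fun _ => ⟨1, rfl⟩) ?_ ?_
    fun t _ => ⟨0, 1, fun g => by simp [h1 (t ()), h1 g]⟩
  · intro k
    have : (Finset.univ : Finset (alternatingGroup (Fin n))) = {1} := by
      ext g; simp [h1 g]
    simp [this, vertex]
  · intro k
    have : (Finset.univ : Finset (alternatingGroup (Fin n))) = {1} := by
      ext g; simp [h1 g]
    simp [this]

theorem sum_vertex_eq_ones {n : ℕ} {G : Subgroup (Equiv.Perm (Fin n))} (s : Finset G)
    (hs : ∀ i j, (s.filter fun g : G => (g : Equiv.Perm (Fin n)) i = j).card = 1) :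
    ∑ g ∈ s, vertex G g = Matrix.of fun _ _ => 1 := by
  ext i j
  simp only [Matrix.sum_apply, vertex, permMatrix_apply', Matrix.of_apply]
  rw [← Finset.sum_filter, Finset.sum_const, hs, one_nsmul]

/-- `P(A₃)` is a simplex: its three vertices form a single class. -/
theorem isTH1Exact_alternatingGroup_three : IsTH1Exact (alternatingGroup (Fin 3)) := by
  refine isTH1Exact_of_transversal (κ := Unit) (fun _ => ()) (Matrix.of fun _ _ => 1) 3
    (fun _ => ⟨1, rfl⟩) (fun k => sum_vertex_eq_ones _ ?_) ?_ fun t _ =>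
      ⟨(1 / 3 : ℝ) • agreement (fun k => (t k : Equiv.Perm (Fin 3))), 0, fun g => ?_⟩
  · revert k; decide
  · decide
  · have h : ∀ g g' : alternatingGroup (Fin 3), Finset.card {i | (g : Equiv.Perm (Fin 3)) i =
      (g' : Equiv.Perm (Fin 3)) i} = if g' = g then 3 else 0 := by decide
    rw [LinearMap.smul_apply, agreement_vertex]
    simp only [h]
    split_ifs <;> simp_all

/-- The label of the coset of the Klein four-group containing `g`. With `Fin 4` identified with
`𝔽₂²` by binary digits, the Klein four-group consists of the translations, and its cosets are told
apart by the nonzero vector `g 0 + g 3`, here a bitwise exclusive or. Its values `1, 2, 3` are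
reduced modulo three. -/
def kleinCoset (g : alternatingGroup (Fin 4)) : Fin 3 :=
  Fin.ofNat 3 (((g : Equiv.Perm (Fin 4)) 0).val ^^^ ((g : Equiv.Perm (Fin 4)) 3).val)

theorem card_agreement_alternatingGroup_four : ∀ g g' : alternatingGroup (Fin 4),
    Finset.card {i | (g : Equiv.Perm (Fin 4)) i = (g' : Equiv.Perm (Fin 4)) i} =
      if g' = g then 4 else if kleinCoset g' = kleinCoset g then 0 else 1 := by
  decide +kernel

/-- `P(A₄)` is a free sum of three tetrahedra, one for each coset of the Klein four-group. A
permutation agrees four times with itself, never with the rest of its coset and once with each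
element of another coset, so counting agreements with a transversal gives `6` on it, `2` off it. -/
theorem isTH1Exact_alternatingGroup_four : IsTH1Exact (alternatingGroup (Fin 4)) := by
  refine isTH1Exact_of_transversal kleinCoset (Matrix.of fun _ _ => 1) 4
    (by decide +kernel) (fun k => sum_vertex_eq_ones _ ?_) (by decide +kernel) fun t ht =>
      ⟨(1 / 4 : ℝ) • agreement (fun k => (t k : Equiv.Perm (Fin 4))), -(1 / 2), fun g => ?_⟩
  · revert k; decide +kernel
  · rw [LinearMap.smul_apply, agreement_vertex]
    simp only [card_agreement_alternatingGroup_four, ht]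
    rw [← Nat.cast_sum]
    by_cases h : t (kleinCoset g) = g
    · have h1 : ∀ k, t k = g ↔ k = kleinCoset g := fun k =>
        ⟨fun hk => by rw [← hk, ht], fun hk => by rw [hk, h]⟩
      have h2 : ∀ m : Fin 3, (∑ k, if k = m then 4 else if k = m then 0 else 1) = 6 := by decide
      simp only [h1, h2, if_true]
      norm_num
    · have h1 : ∀ k, t k ≠ g := fun k hk => h (by rw [← hk, ht])
      have h2 : ∀ m : Fin 3, (∑ k, if k = m then 0 else 1) = 2 := by decide
      simp only [h1, h2, if_false]
      norm_num

/-! ### Weights of odd permutations and facets of the even permutation polytope -/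

/-- The weight of `σ` under the weight matrix `w`, that is, the sum of the entries of `w` in the
positions `(i, σ i)`. -/
def permWeight {n : ℕ} (w : Fin n → Fin n → ℝ) (σ : Equiv.Perm (Fin n)) : ℝ := ∑ i, w i (σ i)

theorem permWeight_eq_of_forall_notMem {n : ℕ} (w : Fin n → Fin n → ℝ) {σ : Equiv.Perm (Fin n)}
    (s : Finset (Fin n)) (hs : ∀ i ∉ s, σ i = i) :
    permWeight w σ = ∑ i, w i i + ∑ i ∈ s, (w i (σ i) - w i i) := by
  rw [Finset.sum_subset (Finset.subset_univ s) fun i _ hi => by rw [hs i hi, sub_self],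
    Finset.sum_sub_distrib, permWeight]
  ring

theorem permWeight_swap {n : ℕ} (w : Fin n → Fin n → ℝ) {a b : Fin n} (hab : a ≠ b) :
    permWeight w (Equiv.swap a b) = ∑ i, w i i + ((w a b - w a a) + (w b a - w b b)) := by
  rw [permWeight_eq_of_forall_notMem w {a, b} fun i hi => ?_, Finset.sum_pair hab]
  · simp
  · simp only [Finset.mem_insert, Finset.mem_singleton, not_or] at hi
    exact Equiv.swap_apply_of_ne_of_ne hi.1 hi.2

/-- The four-cycle `a ↦ d ↦ c ↦ b ↦ a`. -/
def fourCycle {n : ℕ} (a b c d : Fin n) : Equiv.Perm (Fin n) :=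
  Equiv.swap c d * Equiv.swap b c * Equiv.swap a b

theorem sign_fourCycle {n : ℕ} {a b c d : Fin n} (hab : a ≠ b) (hbc : b ≠ c) (hcd : c ≠ d) :
    Equiv.Perm.sign (fourCycle a b c d) = -1 := by
  simp [fourCycle, hab, hbc, hcd]

theorem permWeight_fourCycle {n : ℕ} (w : Fin n → Fin n → ℝ) {a b c d : Fin n}
    (hab : a ≠ b) (hac : a ≠ c) (had : a ≠ d) (hbc : b ≠ c) (hbd : b ≠ d) (hcd : c ≠ d) :
    permWeight w (fourCycle a b c d) = ∑ i, w i i +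
      ((w a d - w a a) + (w b a - w b b) + (w c b - w c c) + (w d c - w d d)) := by
  have ha : fourCycle a b c d a = d := by simp [fourCycle]
  have hb : fourCycle a b c d b = a := by
    simp [fourCycle, Equiv.swap_apply_of_ne_of_ne hab hac, Equiv.swap_apply_of_ne_of_ne hac had]
  have hc : fourCycle a b c d c = b := by
    simp [fourCycle, Equiv.swap_apply_of_ne_of_ne hac.symm hbc.symm,
      Equiv.swap_apply_of_ne_of_ne hbc hbd]
  have hd : fourCycle a b c d d = c := by
    simp [fourCycle, Equiv.swap_apply_of_ne_of_ne had.symm hbd.symm,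
      Equiv.swap_apply_of_ne_of_ne hbd.symm hcd.symm]
  rw [permWeight_eq_of_forall_notMem w {a, b, c, d} fun i hi => ?_,
    Finset.sum_insert (by simp [hab, hac, had]), Finset.sum_insert (by simp [hbc, hbd]),
    Finset.sum_pair hcd, ha, hb, hc, hd]
  · ring
  · simp only [Finset.mem_insert, Finset.mem_singleton, not_or] at hi
    simp [fourCycle, Equiv.swap_apply_of_ne_of_ne, hi]

/-- The linear functional on matrices whose value at the permutation matrix of `g` is the weight
of `g * τ`. For odd `τ` it turns statements on the weights of odd permutations into statements on
even permutation matrices. -/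
noncomputable def weightFunctional {n : ℕ} (τ : Equiv.Perm (Fin n)) (w : Fin n → Fin n → ℝ) :
    Matrix (Fin n) (Fin n) ℝ →ₗ[ℝ] ℝ :=
  ∑ i, ∑ j, w i j • Matrix.entryLinearMap ℝ ℝ (τ i) j

theorem weightFunctional_vertex {n : ℕ} {G : Subgroup (Equiv.Perm (Fin n))}
    (τ : Equiv.Perm (Fin n)) (w : Fin n → Fin n → ℝ) (g : G) :
    weightFunctional τ w (vertex G g) = permWeight w (g * τ) := by
  simp [weightFunctional, permWeight, vertex, permMatrix_apply', -PEquiv.toMatrix_apply]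

theorem exists_eq_weightFunctional {n : ℕ} (τ : Equiv.Perm (Fin n))
    (h : Matrix (Fin n) (Fin n) ℝ →ₗ[ℝ] ℝ) : ∃ w, h = weightFunctional τ w := by
  refine ⟨fun i j => h (Matrix.single (τ i) j 1), LinearMap.ext fun X => ?_⟩
  conv_lhs => rw [Matrix.matrix_eq_sum_single X]
  simp only [weightFunctional, map_sum, LinearMap.sum_apply, LinearMap.smul_apply,
    Matrix.entryLinearMap_apply]
  rw [← Equiv.sum_comp τ]
  refine Finset.sum_congr rfl fun i _ => Finset.sum_congr rfl fun j _ => ?_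
  rw [smul_eq_mul, mul_comm, ← smul_eq_mul, ← map_smul, Matrix.smul_single, smul_eq_mul, mul_one]

/-- A valid inequality `permWeight w σ ≥ α` for the odd permutations defines a facet if every weight
matrix `h` that is constant on the odd permutations attaining equality is a multiple of `w` up to a
row potential and the potentials `u j - u i`, both of which are constant on all permutations. -/
theorem isFacetInequality_weightFunctional {n : ℕ} {τ : Equiv.Perm (Fin n)}
    (hτ : Equiv.Perm.sign τ = -1) {w : Fin n → Fin n → ℝ} {α : ℝ}
    (hvalid : ∀ σ, Equiv.Perm.sign σ = -1 → α ≤ permWeight w σ)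
    (hface : ∃ σ, Equiv.Perm.sign σ = -1 ∧ permWeight w σ = α)
    (hne : ∃ σ, Equiv.Perm.sign σ = -1 ∧ permWeight w σ ≠ α)
    (hrigid : ∀ (h : Fin n → Fin n → ℝ) (β : ℝ),
      (∀ σ, Equiv.Perm.sign σ = -1 → permWeight w σ = α → permWeight h σ = β) →
      ∃ (u : Fin n → ℝ) (k : ℝ), ∀ i j, h i j - h i i = u j - u i + k * w i j) :
    IsFacetInequality (permPolytope (alternatingGroup (Fin n))) (weightFunctional τ w) α := by
  have hodd : ∀ g : alternatingGroup (Fin n), Equiv.Perm.sign ((g : Equiv.Perm (Fin n)) * τ) = -1 :=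
    fun g => by rw [map_mul, Equiv.Perm.mem_alternatingGroup.1 g.2, hτ, one_mul]
  have hsurj : ∀ σ, Equiv.Perm.sign σ = -1 → 
      ∃ g : alternatingGroup (Fin n), σ = (g : Equiv.Perm (Fin n)) * τ :=
    fun σ hσ => ⟨⟨σ * τ⁻¹, by simp [Equiv.Perm.mem_alternatingGroup, hσ, hτ]⟩, by simp⟩
  rw [permPolytope_eq]
  refine isFacetInequality_of_rigid ?_ ?_ ?_ fun h β hh => ?_
  · rintro _ ⟨g, rfl⟩
    rw [weightFunctional_vertex]
    exact hvalid _ (hodd g)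
  · obtain ⟨σ, hσ, hw⟩ := hface
    obtain ⟨g, rfl⟩ := hsurj σ hσ
    exact ⟨_, ⟨g, rfl⟩, by rw [weightFunctional_vertex, hw]⟩
  · obtain ⟨σ, hσ, hw⟩ := hne
    obtain ⟨g, rfl⟩ := hsurj σ hσ
    exact ⟨_, ⟨g, rfl⟩, by rwa [weightFunctional_vertex]⟩
  · obtain ⟨h, rfl⟩ := exists_eq_weightFunctional τ h
    have hh' : ∀ σ, Equiv.Perm.sign σ = -1 → permWeight w σ = α → permWeight h σ = β :=
      fun σ hσ hw => by
        obtain ⟨g, rfl⟩ := hsurj σ hσ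
        have := hh _ ⟨g, rfl⟩ (by rw [weightFunctional_vertex, hw])
        rwa [weightFunctional_vertex] at this
    obtain ⟨u, k, huk⟩ := hrigid h β hh'
    have hk : ∀ σ, permWeight h σ = ∑ i, h i i + k * permWeight w σ := fun σ => by
      have h1 : ∑ i, u (σ i) = ∑ i, u i := Equiv.sum_comp σ u
      have h2 : permWeight h σ = ∑ i, (h i i + (u (σ i) - u i + k * w i (σ i))) :=
        Finset.sum_congr rfl fun i _ => by rw [← huk]; ring
      rw [h2, Finset.sum_add_distrib, Finset.sum_add_distrib, Finset.sum_sub_distrib, h1, sub_self,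
        zero_add, ← Finset.mul_sum, permWeight]
    obtain ⟨σ, hσ, hw⟩ := hface
    have h0 := hk σ
    rw [hh' σ hσ hw, hw] at h0
    refine ⟨k, ?_⟩
    rintro _ ⟨g, rfl⟩
    rw [weightFunctional_vertex, weightFunctional_vertex, hk, h0]
    ring

/-- The weights of the odd permutations are the levels of the vertices over the facet. -/
theorem card_le_of_isKLevel {n k : ℕ} (hk : IsKLevel k (permPolytope (alternatingGroup (Fin n))))
    {τ : Equiv.Perm (Fin n)} (hτ : Equiv.Perm.sign τ = -1) {w : Fin n → Fin n → ℝ} {α : ℝ}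
    (hF : IsFacetInequality (permPolytope (alternatingGroup (Fin n))) (weightFunctional τ w) α)
    (T : Finset ℝ) (hT : ∀ x ∈ T, ∃ σ, Equiv.Perm.sign σ = -1 ∧ permWeight w σ = x) :
    T.card ≤ k := by
  obtain ⟨B, -, hB, hv⟩ := hk _ _ hF
  refine (Finset.card_le_card fun x hx => ?_).trans hB
  obtain ⟨σ, hσ, rfl⟩ := hT x hx
  rw [extremePoints_permPolytope] at hv
  have := hv _ ⟨⟨σ * τ⁻¹, by simp [Equiv.Perm.mem_alternatingGroup, hσ, hτ]⟩, rfl⟩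
  rwa [weightFunctional_vertex, inv_mul_cancel_right] at this

/-! ### The excedance facet -/

/-- The weight matrix that counts excedances, the positions `i` with `i < σ i`. -/
def excedanceWeight (n : ℕ) (i j : Fin n) : ℝ := if i < j then 1 else 0

theorem one_le_permWeight_excedanceWeight {n : ℕ} {σ : Equiv.Perm (Fin n)}
    (hσ : Equiv.Perm.sign σ = -1) : 1 ≤ permWeight (excedanceWeight n) σ := by
  obtain ⟨i, hi⟩ : ∃ i, i < σ i := by
    by_contra! h
    -- A permutation without excedances is the identity: compare the sums of `i` and of `σ i`.
    have h1 : ∑ i, (σ i : ℕ) = ∑ i : Fin n, (i : ℕ) := Equiv.sum_comp σ fun i => (i : ℕ)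
    have h2 := (Finset.sum_eq_sum_iff_of_le fun i _ => Fin.le_def.1 (h i)).1 h1
    have h3 : σ = 1 := Equiv.ext fun i => Fin.ext (h2 i (Finset.mem_univ i))
    rw [h3, map_one] at hσ
    exact absurd hσ (by decide)
  have := Finset.single_le_sum (f := fun i => excedanceWeight n i (σ i))
    (fun i _ => by unfold excedanceWeight; positivity) (Finset.mem_univ i)
  rwa [show excedanceWeight n i (σ i) = 1 from if_pos hi] at this

theorem permWeight_excedanceWeight_cycleRange {n : ℕ} (i : Fin n) :
    permWeight (excedanceWeight n) i.cycleRange = (i : ℕ) := by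
  have h : ∀ j, j < i.cycleRange j ↔ j < i := fun j => by
    rcases lt_trichotomy j i with hj | rfl | hj
    · simp [Fin.lt_def, Fin.coe_cycleRange_of_lt hj, hj]
    · have : NeZero n := ⟨by have := j.2; omega⟩
      simp
    · simp [Fin.cycleRange_of_gt hj, hj.le]
  simp only [permWeight, excedanceWeight, h]
  rw [Finset.sum_boole, Finset.filter_gt_eq_Iio, Fin.card_Iio]

/-- Six points suffice for the four-term relations of a weight to imply the three-term ones. With
`δ a b c = C a b + C b c - C a c - D`, the hypothesis says `δ a b c = -δ a c d` and
`δ a b d = -δ b c d`. On five points a one-parameter family of solutions remains, in which the sign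
of `δ a b c` depends on the parities of the two gaps between the ranks of `a, b, c`; on six points
deleting different points changes these ranks incompatibly, and only `δ = 0` is left. -/
theorem three_term_of_four_term_six (C : Fin 6 → Fin 6 → ℝ) (D : ℝ)
    (H : ∀ a b c d, a < b → b < c → c < d → C a b + C b c + C c d - C a d = 2 * D) :
    ∀ a b c, a < b → b < c → C a b + C b c - C a c = D := by
  have h1 := H 0 1 2 3 (by decide) (by decide) (by decide)
  have h2 := H 0 1 2 4 (by decide) (by decide) (by decide)
  have h3 := H 0 1 2 5 (by decide) (by decide) (by decide)
  have h4 := H 0 1 3 4 (by decide) (by decide) (by decide)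
  have h5 := H 0 1 3 5 (by decide) (by decide) (by decide)
  have h6 := H 0 1 4 5 (by decide) (by decide) (by decide)
  have h7 := H 0 2 3 4 (by decide) (by decide) (by decide)
  have h8 := H 0 2 3 5 (by decide) (by decide) (by decide)
  have h9 := H 0 2 4 5 (by decide) (by decide) (by decide)
  have h10 := H 0 3 4 5 (by decide) (by decide) (by decide)
  have h11 := H 1 2 3 4 (by decide) (by decide) (by decide)
  have h12 := H 1 2 3 5 (by decide) (by decide) (by decide)
  have h13 := H 1 2 4 5 (by decide) (by decide) (by decide)
  have h14 := H 1 3 4 5 (by decide) (by decide) (by decide)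
  have h15 := H 2 3 4 5 (by decide) (by decide) (by decide)
  clear H
  intro a b c hab hbc
  fin_cases a <;> fin_cases b <;> first
    | exact absurd hab (by decide)
    | (fin_cases c <;> first
        | exact absurd hbc (by decide)
        | (simp only [Fin.zero_eta, Fin.mk_one, Fin.reduceFinMk]; linarith))

theorem three_term_of_four_term {n : ℕ} (hn : 6 ≤ n) (C : Fin n → Fin n → ℝ) (D : ℝ)
    (H : ∀ a b c d, a < b → b < c → c < d → C a b + C b c + C c d - C a d = 2 * D)
    {a b c : Fin n} (hab : a < b) (hbc : b < c) : C a b + C b c - C a c = D := by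
  obtain ⟨s, hs, -, hcard⟩ := Finset.exists_subsuperset_card_eq (n := 6)
    (Finset.subset_univ {a, b, c}) (Finset.card_le_three.trans (by norm_num)) (by simpa using hn)
  let e := s.orderEmbOfFin hcard
  have he : ∀ x ∈ s, ∃ i, e i = x := fun x hx => by
    have : x ∈ Set.range e := by rw [Finset.range_orderEmbOfFin]; exact hx
    exact this
  obtain ⟨i, rfl⟩ := he a (hs (by simp))
  obtain ⟨j, rfl⟩ := he b (hs (by simp))
  obtain ⟨k, rfl⟩ := he c (hs (by simp))
  exact three_term_of_four_term_six (fun i j => C (e i) (e j)) D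
    (fun p q r t hpq hqr hrt => H _ _ _ _ (e.strictMono hpq) (e.strictMono hqr) (e.strictMono hrt))
    i j k (e.lt_iff_lt.1 hab) (e.lt_iff_lt.1 hbc)

/-- For `n ≥ 6` the inequality "an odd permutation has at least one excedance" defines a facet. The
odd permutations with exactly one excedance include the transpositions and the four-cycles
`a ↦ d ↦ c ↦ b ↦ a` with `a < b < c < d`, and these already force rigidity. -/
theorem isFacetInequality_excedanceWeight {n : ℕ} (hn : 6 ≤ n) {τ : Equiv.Perm (Fin n)}
    (hτ : Equiv.Perm.sign τ = -1) : IsFacetInequality (permPolytope (alternatingGroup (Fin n)))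
      (weightFunctional τ (excedanceWeight n)) 1 := by
  have hswap : ∀ a b : Fin n, a < b → permWeight (excedanceWeight n) (Equiv.swap a b) = 1 :=
    fun a b hab => by
      rw [permWeight_swap _ hab.ne]
      simp [excedanceWeight, hab, hab.not_gt]
  have hfour : ∀ a b c d : Fin n, a < b → b < c → c < d →
      permWeight (excedanceWeight n) (fourCycle a b c d) = 1 := fun a b c d hab hbc hcd => by
    have hac := hab.trans hbc
    have hbd := hbc.trans hcd
    have had := hac.trans hcd
    rw [permWeight_fourCycle _ hab.ne hac.ne had.ne hbc.ne hbd.ne hcd.ne]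
    simp [excedanceWeight, had, hab.not_gt, hbc.not_gt, hcd.not_gt]
  refine isFacetInequality_weightFunctional hτ (fun σ hσ => one_le_permWeight_excedanceWeight hσ)
    ⟨Equiv.swap ⟨0, by omega⟩ ⟨1, by omega⟩, Equiv.Perm.sign_swap (by simp),
      hswap _ _ (by simp [Fin.lt_def])⟩
    ⟨Fin.cycleRange ⟨3, by omega⟩, by rw [Fin.sign_cycleRange]; exact Odd.neg_one_pow ⟨1, rfl⟩, by
      rw [permWeight_excedanceWeight_cycleRange]; norm_num⟩ fun h β hh => ?_
  set D := β - ∑ i, h i i with hD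
  set C : Fin n → Fin n → ℝ := fun i j => h i j - h i i with hC
  have h2 : ∀ a b, a < b → C a b + C b a = D := fun a b hab => by
    have := hh _ (Equiv.Perm.sign_swap hab.ne) (hswap a b hab)
    rw [permWeight_swap _ hab.ne] at this
    simp only [hC, hD]
    linarith
  have h4 : ∀ a b c d, a < b → b < c → c < d → C a b + C b c + C c d - C a d = 2 * D :=
    fun a b c d hab hbc hcd => by
      have hac := hab.trans hbc
      have hbd := hbc.trans hcd
      have had := hac.trans hcd
      have := hh _ (sign_fourCycle hab.ne hbc.ne hcd.ne) (hfour a b c d hab hbc hcd)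
      rw [permWeight_fourCycle _ hab.ne hac.ne had.ne hbc.ne hbd.ne hcd.ne] at this
      have e1 := h2 a b hab
      have e2 := h2 b c hbc
      have e3 := h2 c d hcd
      simp only [hC, hD] at e1 e2 e3 ⊢
      linarith
  have h3 : ∀ a b c, a < b → b < c → C a b + C b c - C a c = D :=
    fun a b c hab hbc => three_term_of_four_term hn C D h4 hab hbc
  -- the potential is the distance from the first point, corrected by its excedance
  let o : Fin n := ⟨0, by omega⟩
  let u : Fin n → ℝ := fun j => if o < j then C o j - D else 0
  have hup : ∀ a b, a < b → C a b = u b - u a + D := fun a b hab => by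
    have hob : o < b := lt_of_le_of_lt (Nat.zero_le _ : o ≤ a) hab
    rcases (show o ≤ a from Nat.zero_le _).eq_or_lt with ha | ha
    · simp only [u, hob, if_true, ← ha, lt_irrefl, if_false]
      ring
    · simp only [u, hob, ha, if_true]
      linarith [h3 o a b ha hab]
  refine ⟨u, D, fun i j => ?_⟩
  change C i j = _
  rcases lt_trichotomy i j with hij | rfl | hij
  · simp [excedanceWeight, hij, hup i j hij]
  · simp [hC, excedanceWeight]
  · have := h2 j i hij
    rw [hup j i hij] at this
    simp only [excedanceWeight, hij.not_gt, if_false]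
    linarith

/-- The cycles `(0 1 … i)` with `i` odd are odd permutations with exactly `i` excedances, so the
excedance facet alone needs `n / 2` parallel hyperplanes. -/
theorem half_le_of_isKLevel {n k : ℕ} (hn : 6 ≤ n)
    (hk : IsKLevel k (permPolytope (alternatingGroup (Fin n)))) : n / 2 ≤ k := by
  have hτ : Equiv.Perm.sign (Equiv.swap (⟨0, by omega⟩ : Fin n) ⟨1, by omega⟩) = -1 :=
    Equiv.Perm.sign_swap (by simp)
  have h := card_le_of_isKLevel hk hτ (isFacetInequality_excedanceWeight hn hτ)
    ((Finset.range (n / 2)).image fun t => ((2 * t + 1 : ℕ) : ℝ)) fun x hx => by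
      obtain ⟨t, ht, rfl⟩ := Finset.mem_image.1 hx
      have := Finset.mem_range.1 ht
      refine ⟨Fin.cycleRange ⟨2 * t + 1, by omega⟩, ?_, permWeight_excedanceWeight_cycleRange _⟩
      rw [Fin.sign_cycleRange]
      exact Odd.neg_one_pow ⟨t, rfl⟩
  rwa [Finset.card_image_of_injective _ fun s t h => by simpa using h, Finset.card_range] at h

/-! ### Degree five -/

/-- An integral weight matrix refining twice the excedance weight: excedances across an even gap
count one more, and anti-excedances across an even gap one less. The correction spans the
one-parameter family of solutions described at `three_term_of_four_term_six`. -/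
def parityWeight (i j : Fin 5) : ℤ :=
  if i < j then (if Even (j.val - i.val) then 3 else 2)
  else if j < i ∧ Even (i.val - j.val) then -1 else 0

theorem permWeight_intCast {n : ℕ} (w : Fin n → Fin n → ℤ) (σ : Equiv.Perm (Fin n)) :
    permWeight (fun i j => (w i j : ℝ)) σ = ((∑ i, w i (σ i) : ℤ) : ℝ) := by
  simp [permWeight]

/-- The degree five replacement of `isFacetInequality_excedanceWeight`: transpositions and
four-cycles with one excedance still attain equality but span one dimension too little, and tilting
the inequality by the correction brings in further odd permutations. -/
theorem isFacetInequality_parityWeight {τ : Equiv.Perm (Fin 5)} (hτ : Equiv.Perm.sign τ = -1) :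
    IsFacetInequality (permPolytope (alternatingGroup (Fin 5)))
      (weightFunctional τ fun i j => (parityWeight i j : ℝ)) 2 := by
  have hw := permWeight_intCast parityWeight
  have hvalid : ∀ σ : Equiv.Perm (Fin 5), Equiv.Perm.sign σ = -1 →
    2 ≤ ∑ i, parityWeight i (σ i) := by decide +kernel
  have hswap : ∀ a b : Fin 5, a < b → ∑ i, parityWeight i (Equiv.swap a b i) = 2 := by
    decide +kernel
  have hfour : ∀ a b c d : Fin 5, a < b → b < c → c < d →
      ∑ i, parityWeight i (fourCycle a b c d i) = 2 := by
    decide +kernel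
  refine isFacetInequality_weightFunctional hτ (fun σ hσ => ?_)
    ⟨Equiv.swap 0 1, by decide, by rw [hw, hswap 0 1 (by decide)]; norm_num⟩
    ⟨Fin.cycleRange 3, by rw [Fin.sign_cycleRange]; decide, ?_⟩ fun h β hh => ?_
  · rw [hw]
    exact_mod_cast hvalid σ hσ
  · rw [hw, show ∑ i, parityWeight i (Fin.cycleRange 3 i) = 6 by decide +kernel]
    norm_num
  set D := β - ∑ i, h i i with hD
  set C : Fin 5 → Fin 5 → ℝ := fun i j => h i j - h i i with hC
  have h2 : ∀ a b, a < b → C a b + C b a = D := fun a b hab => by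
    have := hh _ (Equiv.Perm.sign_swap hab.ne) (by rw [hw, hswap a b hab]; norm_num)
    rw [permWeight_swap _ hab.ne] at this
    simp only [hC, hD]
    linarith
  have h4 : ∀ a b c d, a < b → b < c → c < d → C a d + C b a + C c b + C d c = D :=
    fun a b c d hab hbc hcd => by
      have hac := hab.trans hbc
      have hbd := hbc.trans hcd
      have had := hac.trans hcd
      have := hh _ (sign_fourCycle hab.ne hbc.ne hcd.ne)
        (by rw [hw, hfour a b c d hab hbc hcd]; norm_num)
      rw [permWeight_fourCycle _ hab.ne hac.ne had.ne hbc.ne hbd.ne hcd.ne] at this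
      simp only [hC, hD]
      linarith
  -- the further vertex `1 ↦ 4 ↦ 2 ↦ 3 ↦ 1` of the facet removes the last degree of freedom
  have hx : C 1 4 + C 3 1 + C 2 3 + C 4 2 = D := by
    have := hh (fourCycle 1 3 2 4) (sign_fourCycle (by decide) (by decide) (by decide))
      (by rw [hw, show ∑ i, parityWeight i (fourCycle 1 3 2 4 i) = 2 by decide +kernel]; norm_num)
    rw [permWeight_fourCycle _ (by decide) (by decide) (by decide) (by decide) (by decide)
      (by decide)] at this
    simp only [hC, hD]
    linarith
  have e01 := h2 0 1 (by decide)
  have e02 := h2 0 2 (by decide)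
  have e03 := h2 0 3 (by decide)
  have e04 := h2 0 4 (by decide)
  have e12 := h2 1 2 (by decide)
  have e13 := h2 1 3 (by decide)
  have e14 := h2 1 4 (by decide)
  have e23 := h2 2 3 (by decide)
  have e24 := h2 2 4 (by decide)
  have e34 := h2 3 4 (by decide)
  have f0 := h4 1 2 3 4 (by decide) (by decide) (by decide)
  have f1 := h4 0 2 3 4 (by decide) (by decide) (by decide)
  have f2 := h4 0 1 3 4 (by decide) (by decide) (by decide)
  have f3 := h4 0 1 2 4 (by decide) (by decide) (by decide)
  have f4 := h4 0 1 2 3 (by decide) (by decide) (by decide)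
  have hdiag : ∀ i, C i i = 0 := fun i => sub_self _
  refine ⟨fun j => C 0 j - D / 2 * parityWeight 0 j, D / 2, fun i j => ?_⟩
  change C i j = _
  have hd := hdiag i
  have h0 := hdiag 0
  clear_value C D
  clear h2 h4 hdiag hvalid hswap hfour hw hh
  fin_cases i <;> fin_cases j <;>
    simp only [Fin.zero_eta, Fin.mk_one, Fin.reduceFinMk] at hd ⊢ <;>
    norm_num [parityWeight, Fin.lt_def, Fin.ext_iff, Nat.even_iff] <;> linarith

theorem not_isTwoLevel_five : ¬ IsTwoLevel (permPolytope (alternatingGroup (Fin 5))) := by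
  rw [isTwoLevel_iff_isKLevel_two]
  intro hk
  have hw := permWeight_intCast parityWeight
  have hτ : Equiv.Perm.sign (Equiv.swap (0 : Fin 5) 1) = -1 := by decide
  have h := card_le_of_isKLevel hk hτ (isFacetInequality_parityWeight hτ) {2, 4, 6} fun x hx => by
    simp only [Finset.mem_insert, Finset.mem_singleton] at hx
    rcases hx with rfl | rfl | rfl
    · exact ⟨Equiv.swap 0 1, hτ, by
        rw [hw, show ∑ i, parityWeight i (Equiv.swap 0 1 i) = 2 by decide +kernel]; norm_num⟩
    · exact ⟨fourCycle 0 2 3 1, by decide +kernel, by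
        rw [hw, show ∑ i, parityWeight i (fourCycle 0 2 3 1 i) = 4 by decide +kernel]; norm_num⟩
    · exact ⟨Fin.cycleRange 3, by decide +kernel, by
        rw [hw, show ∑ i, parityWeight i (Fin.cycleRange 3 i) = 6 by decide +kernel]; norm_num⟩
  norm_num at h

theorem proposition2 (n : ℕ) :
    (IsTwoLevel (permPolytope (alternatingGroup (Fin n))) ↔ n ≤ 4) ∧
    (IsTH1Exact (alternatingGroup (Fin n)) ↔ n ≤ 4) ∧
    (8 ≤ n → IsAtLeastLevel (n / 4 + 1) (permPolytope (alternatingGroup (Fin n)))) := by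
  have hexact : n ≤ 4 → IsTH1Exact (alternatingGroup (Fin n)) := fun hn => by
    rcases (show n ≤ 2 ∨ n = 3 ∨ n = 4 by omega) with h | rfl | rfl
    · exact isTH1Exact_alternatingGroup_of_le_two h
    · exact isTH1Exact_alternatingGroup_three
    · exact isTH1Exact_alternatingGroup_four
  have hlevel : IsTwoLevel (permPolytope (alternatingGroup (Fin n))) → n ≤ 4 := fun h => by
    by_contra! hn
    rcases (show n = 5 ∨ 6 ≤ n by omega) with rfl | h6
    · exact not_isTwoLevel_five h
    · have := half_le_of_isKLevel h6 ((isTwoLevel_iff_isKLevel_two _).1 h)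
      omega
  refine ⟨⟨hlevel, fun hn => (hexact hn).isTwoLevel⟩, ⟨fun h => hlevel h.isTwoLevel, hexact⟩,
    fun hn k hk => ?_⟩
  have := half_le_of_isKLevel (by omega) hk
  omega
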